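/- **Setting.** Fix a set $\Omega_1'$ of unary operation symbols, a set $\Omega_2'$ of binary operation symbols and an assignment $*\mapsto *^\circ$ on $\Omega_2'$. A *group with operations* is a group $(X,0,-,+)$ (written additively, not necessarily commutative) with unary operations $\omega\in\Omega_1'$ and binary operations $*\in\Omega_2'$ such that $x*^\circ y=y*x$, $x*(y+z)=x*y+x*z$, $\omega(x+y)=\omega(x)+\omega(y)$ and $\omega(x)*y=\omega(x*y)$. A *category of interest* $\mathbb C$ is the full category of those groups with operations which satisfy 1. $x_1+(x_2*x_3)=(x_2*x_3)+x_1$ for all $*\in\Omega_2'$; 2. for each ordered pair $(*,\overline*)$ in $\Omega_2'$ an identity $(x_1*x_2)\,\overline*\,x_3=W(x_1,x_2;x_3;*,\overline*)$, where $W$ is a given word in expressions of the forms $x_1(x_2x_3)$, $x_1(x_3x_2)$, $(x_2x_3)x_1$, $(x_3x_2)x_1$, $x_2(x_1x_3)$, $x_2(x_3x_1)$, $(x_1x_3)x_2$, $(x_3x_1)x_2$, each juxtaposition being some operation in $\Omega_2'$; 3. an arbitrary given set of further identities in these operations. Morphisms are the homomorphisms for all operations. An *action in $\mathbb C$* of $B\in\mathbb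 C$ on $A\in\mathbb C$ is a family of maps $(b,a)\mapsto b\cdot a$ and $(b,a)\mapsto b*a$ ($*\in\Omega_2'$) from $B\times A$ to $A$ that arises from a split extension $0\to A\xrightarrow{i}E\xrightarrow{p}B\to0$ in $\mathbb C$, with section $s$ in $\mathbb C$, by $i(b\cdot a)=s(b)+i(a)-s(b)$ and $i(b*a)=s(b)*i(a)$. One writes $a*b$ for $b*^\circ a$. A *crossed module* $\partial:A\to B$ in $\mathbb C$ is a morphism together with an action in $\mathbb C$ of $B$ on $A$ such that $\partial(b\cdot a)=b+\partial(a)-b$, $\partial(a)\cdot a'=a+a'-a$, $\partial(a)*a'=a*a'$, $\partial(b*a)=b*\partial(a)$ and $\partial(a*b)=\partial(a)*b$. An *actor* of $A$ is a crossed module $\partial:A\to\mathrm{Actor}(A)$ in $\mathbb C$ such that for every $D\in\mathbb C$ and every action in $\mathbb C$ of $D$ on $A$ there is a unique morphism $\varphi:D\to\mathrm{Actor}(A)$ with $c\cdot a=\varphi(c)\cdot a$ and $c*a=\varphi(c)*a$ for all $c\in D$, $a\in A$, $*\in\Omega_2'$. **The algebra $\mathfrak B(A)$.** Let $A\in\mathbb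 C$. For every action in $\mathbb C$ of an object $B$ on $A$ and every $b\in B$ let $\mathbf b$ be the family of maps $b\,\cdot\,$, $b\,*\,$ ($*\in\Omega_2'$) from $A$ to $A$, together with those of all elements $\omega_1\cdots\omega_n b$ with $\omega_1,\dots,\omega_n\in\Omega_1'$. Then $\mathfrak B(A)$ consists of everything obtained from such elements $\mathbf b$ by the operations $$(f+g)\cdot a=f\cdot(g\cdot a),\quad (f+g)*a=f*a+g*a,\quad (-f)\,\cdot\,=(f\,\cdot\,)^{-1},\quad (-f)*a=-(f*a),$$ $$(f*g)\cdot a=a,\qquad (f*g)\,\overline*\,a=W(f,g;a;*,\overline*),$$ $$\omega(\mathbf b)=\boldsymbol{\omega(b)},\quad \omega(f+g)=\omega(f)+\omega(g),\quad \omega(-f)=-\omega(f),\quad \omega(f*g)=\omega(f)*g,$$ the zero element being the identity permutation $0\cdot a=a$ with $0*a=0$. Two elements $f,g$ are identified if and only if, for every finite (possibly empty) sequence $\omega_1,\dots,\omega_n$ in $\Omega_1'$, the elements $\omega_1\cdots\omega_nf$ and $\omega_1\cdots\omega_ng$ have the same actions $\,\cdot\,$ and $*$ ($*\in\Omega_2'$)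 on $A$. Finally $d:A\to\mathfrak B(A)$ sends $a$ to the element given by the conjugation action $a\cdot a'=a+a'-a$, $a*a'=a*a'$ of $A$ on itself. **Proposition.** Let $A$ be an object of a category of interest $\mathbb C$. If $A$ has an actor $\partial:A\to\mathrm{Actor}(A)$ in $\mathbb C$, then $\mathfrak B(A)=\mathrm{Actor}(A)$: there is a bijection $e:\mathrm{Actor}(A)\to\mathfrak B(A)$ which preserves all operations and satisfies $e(x)\cdot a=x\cdot a$, $e(x)*a=x*a$ and $e(\partial(a))=d(a)$ for all $x\in\mathrm{Actor}(A)$, $a\in A$ and $*\in\Omega_2'$. -/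

import Mathlib

universe u v w

set_option linter.checkUnivs false

/-- The operation symbols besides the group operations `0`, `-`, `+`: the unary symbols `Ω₁'`, the
binary symbols `Ω₂'`, and the assignment `* ↦ *°` on `Ω₂'`. -/
structure OpSignature where
  Unary : Type v
  Star : Type w
  opp : Star → Star

/-- A universal algebra with operations `Ω` whose operations `0, -, +` satisfy the (additively
written, not necessarily commutative) group laws. No law is imposed on the other operations. -/
class OmegaGroup (T : OpSignature.{v, w}) (X : Type u) extends AddGroup X where
  /-- the unary operations `ω ∈ Ω₁'` -/
  unary : T.Unary → X → X
  /-- the binary operations `* ∈ Ω₂'`: `star s x y` is `x * y` -/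
  star : T.Star → X → X → X

/-- Words in all the operations of `Ω` with variables from `V`. -/
inductive OpTerm (T : OpSignature.{v, w}) (V : Type u) : Type (max u v w)
  | var : V → OpTerm T V
  | zero : OpTerm T V
  | neg : OpTerm T V → OpTerm T V
  | add : OpTerm T V → OpTerm T V → OpTerm T V
  | unary : T.Unary → OpTerm T V → OpTerm T V
  | star : T.Star → OpTerm T V → OpTerm T V → OpTerm T V

/-- The value of a word under an assignment of its variables. -/
def OpTerm.eval {T : OpSignature.{v, w}} {V : Type*} {X : Type u} [OmegaGroup T X] (x : V → X) :
    OpTerm T V → X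
  | .var i => x i
  | .zero => 0
  | .neg t => -(t.eval x)
  | .add t₁ t₂ => t₁.eval x + t₂.eval x
  | .unary o t => OmegaGroup.unary o (t.eval x)
  | .star s t₁ t₂ => OmegaGroup.star s (t₁.eval x) (t₂.eval x)

/-- The arguments of the word `W` in the identity `(x₁ * x₂) *̄ x₃ = W`. In each of the eight shapes `p` is the
operation of the outer juxtaposition, `q` that of the inner one. -/
inductive Mono (T : OpSignature.{v, w}) : Type w
  /-- `x₁ (x₂ x₃)` -/
  | m1_23 (p q : T.Star) : Mono T
  /-- `x₁ (x₃ x₂)` -/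
  | m1_32 (p q : T.Star) : Mono T
  /-- `(x₂ x₃) x₁` -/
  | m23_1 (p q : T.Star) : Mono T
  /-- `(x₃ x₂) x₁` -/
  | m32_1 (p q : T.Star) : Mono T
  /-- `x₂ (x₁ x₃)` -/
  | m2_13 (p q : T.Star) : Mono T
  /-- `x₂ (x₃ x₁)` -/
  | m2_31 (p q : T.Star) : Mono T
  /-- `(x₁ x₃) x₂` -/
  | m13_2 (p q : T.Star) : Mono T
  /-- `(x₃ x₁) x₂` -/
  | m31_2 (p q : T.Star) : Mono T

/-- The value of the monomials at three elements of an algebra. -/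
def Mono.eval {T : OpSignature.{v, w}} {X : Type u} [OmegaGroup T X] (x₁ x₂ x₃ : X) : Mono T → X
  | .m1_23 p q => OmegaGroup.star p x₁ (OmegaGroup.star q x₂ x₃)
  | .m1_32 p q => OmegaGroup.star p x₁ (OmegaGroup.star q x₃ x₂)
  | .m23_1 p q => OmegaGroup.star p (OmegaGroup.star q x₂ x₃) x₁
  | .m32_1 p q => OmegaGroup.star p (OmegaGroup.star q x₃ x₂) x₁
  | .m2_13 p q => OmegaGroup.star p x₂ (OmegaGroup.star q x₁ x₃)
  | .m2_31 p q => OmegaGroup.star p x₂ (OmegaGroup.star q x₃ x₁)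
  | .m13_2 p q => OmegaGroup.star p (OmegaGroup.star q x₁ x₃) x₂
  | .m31_2 p q => OmegaGroup.star p (OmegaGroup.star q x₃ x₁) x₂

/-- The value of the monomials at `(b₁, b₂, a)` with `a ∈ A`, where `b₁` and `b₂` are only known
through their star actions `f₁ * = b₁ * -` and `f₂ * = b₂ * -` on `A`; here `a * b` means
`b *° a`. -/
def Mono.actEval {T : OpSignature.{v, w}} {A : Type u} (f₁ f₂ : T.Star → A → A) (a : A) :
    Mono T → A
  | .m1_23 p q => f₁ p (f₂ q a)
  | .m1_32 p q => f₁ p (f₂ (T.opp q) a)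
  | .m23_1 p q => f₁ (T.opp p) (f₂ q a)
  | .m32_1 p q => f₁ (T.opp p) (f₂ (T.opp q) a)
  | .m2_13 p q => f₂ p (f₁ q a)
  | .m2_31 p q => f₂ p (f₁ (T.opp q) a)
  | .m13_2 p q => f₂ (T.opp p) (f₁ q a)
  | .m31_2 p q => f₂ (T.opp p) (f₁ (T.opp q) a)

/-- The laws of a group with operations (besides the group laws): `x *° y = y * x`, `x * (y + z) =
x * y + x * z`, `ω (x + y) = ω x + ω y` and `ω x * y = ω (x * y)`. -/
structure IsGroupWithOperations (T : OpSignature.{v, w}) (X : Type u) [OmegaGroup T X] : Prop where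
  star_opp : ∀ (s : T.Star) (x y : X), OmegaGroup.star (T.opp s) x y = OmegaGroup.star s y x
  star_add : ∀ (s : T.Star) (x y z : X),
    OmegaGroup.star s x (y + z) = OmegaGroup.star s x y + OmegaGroup.star s x z
  unary_add : ∀ (o : T.Unary) (x y : X),
    OmegaGroup.unary o (x + y) = OmegaGroup.unary o x + OmegaGroup.unary o y
  unary_star : ∀ (o : T.Unary) (s : T.Star) (x y : X),
    OmegaGroup.star s (OmegaGroup.unary o x) y = OmegaGroup.unary o (OmegaGroup.star s x y)

/-- A category of interest, given by its operations, the words `W` with `(x₁ * x₂) *̄ x₃ = W` (one for every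
ordered pair of operations in `Ω₂'`) and an arbitrary set of further identities. -/
structure CategoryOfInterest where
  sig : OpSignature.{v, w}
  /-- `word s t` is the word `W` for `(x₁ s x₂) t x₃` -/
  word : sig.Star → sig.Star → OpTerm sig (Mono sig)
  /-- the remaining identities -/
  identities : Set (OpTerm sig ℕ × OpTerm sig ℕ)

/-- `X` is an object of the category of interest `C`. -/
structure CategoryOfInterest.Obj (C : CategoryOfInterest.{v, w}) (X : Type u) [OmegaGroup C.sig X] :
    Prop extends IsGroupWithOperations C.sig X where
  /-- the values of every `*` are central for `+` -/
  add_star_comm : ∀ (s : C.sig.Star) (x₁ x₂ x₃ : X),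
    x₁ + OmegaGroup.star s x₂ x₃ = OmegaGroup.star s x₂ x₃ + x₁
  /-- the identity `(x₁ * x₂) *̄ x₃ = W` -/
  star_star : ∀ (s t : C.sig.Star) (x₁ x₂ x₃ : X),
    OmegaGroup.star t (OmegaGroup.star s x₁ x₂) x₃ = (C.word s t).eval (Mono.eval x₁ x₂ x₃)
  identity : ∀ e ∈ C.identities, ∀ x : ℕ → X, e.1.eval x = e.2.eval x

/-- Homomorphisms of `Ω`-algebras (`0` and `-` are preserved automatically). -/
structure IsOmegaHom (T : OpSignature.{v, w}) {X Y : Type*} [OmegaGroup T X] [OmegaGroup T Y]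
    (f : X → Y) : Prop where
  map_add : ∀ x y, f (x + y) = f x + f y
  map_unary : ∀ (o : T.Unary) x, f (OmegaGroup.unary o x) = OmegaGroup.unary o (f x)
  map_star : ∀ (s : T.Star) x y, f (OmegaGroup.star s x y) = OmegaGroup.star s (f x) (f y)

/-- A set of actions of `B` on `A`: one map `B × A → A` for `+` (written `b · a`) and one for every
`* ∈ Ω₂'` (written `b * a`). -/
structure ActionSet (T : OpSignature.{v, w}) (B A : Type u) where
  dot : B → A → A
  star : T.Star → B → A → A

namespace CategoryOfInterest

variable (C : CategoryOfInterest.{v, w})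

/-- A set of actions of `B` on `A` is derived in `C` (an action in `C`) if it comes from a split
extension `0 → A → E → B → 0` in `C` by `b · a = s(b) + a - s(b)` and `b * a = s(b) * a`. -/
def IsDerived {B A : Type u} [OmegaGroup C.sig B] [OmegaGroup C.sig A]
    (α : ActionSet C.sig B A) : Prop :=
  ∃ (E : Type u) (_ : OmegaGroup C.sig E) (i : A → E) (p : E → B) (s : B → E),
    C.Obj E ∧ IsOmegaHom C.sig i ∧ IsOmegaHom C.sig p ∧ IsOmegaHom C.sig s ∧
    Function.Injective i ∧ Function.Surjective p ∧ (∀ x, p x = 0 ↔ x ∈ Set.range i) ∧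
    (∀ b, p (s b) = b) ∧
    (∀ b a, i (α.dot b a) = s b + i a - s b) ∧
    (∀ t b a, i (α.star t b a) = OmegaGroup.star t (s b) (i a))

/-- Crossed modules `∂ : A → B` in `C`, with `α` the action of `B` on `A`. -/
structure IsCrossedModule {A B : Type u} [OmegaGroup C.sig A] [OmegaGroup C.sig B]
    (del : A → B) (α : ActionSet C.sig B A) : Prop where
  obj_source : C.Obj A
  obj_target : C.Obj B
  derived : C.IsDerived α
  hom : IsOmegaHom C.sig del
  del_dot : ∀ b a, del (α.dot b a) = b + del a - b
  dot_del : ∀ a a', α.dot (del a) a' = a + a' - a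
  star_del : ∀ t a a', α.star t (del a) a' = OmegaGroup.star t a a'
  del_star_left : ∀ t b a, del (α.star t b a) = OmegaGroup.star t b (del a)
  del_star_right : ∀ t b a, del (α.star (C.sig.opp t) b a) = OmegaGroup.star t (del a) b

/-- The crossed module `∂ : A → B` is an actor of `A` in `C`: every action in `C` of an object of
`C` on `A` is induced by a unique morphism to `B`. -/
structure IsActor {A B : Type u} [OmegaGroup C.sig A] [OmegaGroup C.sig B]
    (del : A → B) (α : ActionSet C.sig B A) : Prop where
  crossed : C.IsCrossedModule del α
  universal : ∀ (D : Type u) [OmegaGroup C.sig D], C.Obj D →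
    ∀ β : ActionSet C.sig D A, C.IsDerived β →
      ∃! φ : D → B, IsOmegaHom C.sig φ ∧
        (∀ c a, β.dot c a = α.dot (φ c) a) ∧ ∀ t c a, β.star t c a = α.star t (φ c) a

/-- The functions from which `𝔅(A)` is built. Such an `f` records a permutation `f w ·` and maps
`f w *` of `A` for every finite sequence `w = [ω₁, …, ωₙ]` in `Ω₁'`; they stand for the actions
of the element `ω₁ ⋯ ωₙ b` on `A`, and `w = []` gives the actions of `b` itself, so that two
functions are equal if all these actions agree (`BAlg.eq_iff` below shows which of them are enough
in `𝔅(A)` when these words `W` do not involve `Ω₂'`). As an additive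
group it is a product: `(f + g) · a = f · (g · a)` and `(f + g) * a = f * a + g * a`, and
`(- f) ·` is inverse to `f ·`, `(- f) * a = -(f * a)`, for every `w`. -/
def Ops (A : Type u) [OmegaGroup C.sig A] : Type (max u v w) :=
  List C.sig.Unary → Additive (Equiv.Perm A) × (C.sig.Star → A → A)

variable {C} in
/-- `f · a` -/
def Ops.dot {A : Type u} [OmegaGroup C.sig A] (f : C.Ops A) (a : A) : A :=
  (f []).1.toMul a

variable {C} in
/-- `f * a` -/
def Ops.star {A : Type u} [OmegaGroup C.sig A] (f : C.Ops A) (s : C.sig.Star) (a : A) : A :=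
  (f []).2 s a

instance (A : Type u) [OmegaGroup C.sig A] : AddGroup (C.Ops A) :=
  inferInstanceAs
    (AddGroup (List C.sig.Unary → Additive (Equiv.Perm A) × (C.sig.Star → A → A)))

/-- The operations on these functions: `ω₁ ⋯ ωₙ (ω f)` is `f` at the sequence `ω₁, …, ωₙ, ω`;
`(f * g) · a = a` and `(f * g) *̄ a = W(f, g; a; *, *̄)`, with `ω (f * g) = (ω f) * g`. -/
instance (A : Type u) [OmegaGroup C.sig A] : OmegaGroup C.sig (C.Ops A) where
  unary o f := fun l => f (l ++ [o])
  star s f g := fun l => (0, fun t a => (C.word s t).eval (Mono.actEval (f l).2 (g []).2 a))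

/-- `ω₁ (ω₂ (⋯ (ωₙ x)))` -/
def iterUnary {X : Type*} [OmegaGroup C.sig X] (l : List C.sig.Unary) (x : X) : X :=
  l.foldr OmegaGroup.unary x

variable {C}

theorem IsDerived.bijective_dot {B A : Type u} [OmegaGroup C.sig B] [OmegaGroup C.sig A]
    {α : ActionSet C.sig B A} (h : C.IsDerived α) (b : B) : Function.Bijective (α.dot b) := by
  obtain ⟨E, _, i, p, s, -, -, -, hs, hi, -, -, -, hd, -⟩ := h
  have hneg : ∀ x, s (-x) = -s x := fun x =>
    map_neg (AddMonoidHom.mk' s hs.map_add) x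
  refine ⟨fun a a' haa => hi ?_, fun a => ⟨α.dot (-b) a, hi ?_⟩⟩
  · have := congrArg i haa
    rw [hd, hd] at this
    simpa using this
  · rw [hd, hd, hneg]
    simp [sub_eq_add_neg, add_assoc]

/-- The element `𝐛` given by an element `b` of an object acting on `A`. -/
noncomputable def toOps {B A : Type u} [OmegaGroup C.sig B] [OmegaGroup C.sig A]
    {α : ActionSet C.sig B A} (h : C.IsDerived α) (b : B) : C.Ops A :=
  fun l => (Additive.ofMul (Equiv.ofBijective _ (h.bijective_dot (C.iterUnary l b))),
    fun t a => α.star t (C.iterUnary l b) a)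

variable (C)

/-- Membership in `𝔅(A)`: the functions obtained by the operations of `Ω` from the elements `𝐛`, for
all actions in `C` of all objects of `C` on `A`. -/
inductive MemB (A : Type u) [OmegaGroup C.sig A] : C.Ops A → Prop
  | gen {B : Type u} [OmegaGroup C.sig B] (hB : C.Obj B) (α : ActionSet C.sig B A)
      (h : C.IsDerived α) (b : B) : MemB A (toOps h b)
  | zero : MemB A 0
  | neg {f : C.Ops A} : MemB A f → MemB A (-f)
  | add {f g : C.Ops A} : MemB A f → MemB A g → MemB A (f + g)
  | unary (o : C.sig.Unary) {f : C.Ops A} : MemB A f → MemB A (OmegaGroup.unary o f)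
  | star (s : C.sig.Star) {f g : C.Ops A} : MemB A f → MemB A g → MemB A (OmegaGroup.star s f g)

/-- `𝔅(A)` as a subgroup of the group of all functions. -/
def subgroupB (A : Type u) [OmegaGroup C.sig A] : AddSubgroup (C.Ops A) where
  carrier := {f | C.MemB A f}
  zero_mem' := .zero
  add_mem' := .add
  neg_mem' := .neg

/-- The `Ω`-algebra `𝔅(A)`. -/
def BAlg (A : Type u) [OmegaGroup C.sig A] : Type (max u v w) := C.subgroupB A

instance (A : Type u) [OmegaGroup C.sig A] : AddGroup (C.BAlg A) :=
  inferInstanceAs (AddGroup (C.subgroupB A))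

instance (A : Type u) [OmegaGroup C.sig A] : OmegaGroup C.sig (C.BAlg A) where
  unary o f := ⟨OmegaGroup.unary o f.1, .unary o f.2⟩
  star s f g := ⟨OmegaGroup.star s f.1 g.1, .star s f.2 g.2⟩

/-- The set of actions of `𝔅(A)` on `A`: `b · a` is the value of `b ·` at `a`. -/
def BAlg.dot {C : CategoryOfInterest.{v, w}} {A : Type u} [OmegaGroup C.sig A]
    (b : C.BAlg A) (a : A) : A := Ops.dot b.1 a

/-- The set of actions of `𝔅(A)` on `A`: `b * a` is the value of `b *` at `a`. -/
def BAlg.star {C : CategoryOfInterest.{v, w}} {A : Type u} [OmegaGroup C.sig A]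
    (b : C.BAlg A) (s : C.sig.Star) (a : A) : A := Ops.star b.1 s a

/-- The conjugation action of `A` on itself. -/
def conj (A : Type u) [OmegaGroup C.sig A] : ActionSet C.sig A A where
  dot a a' := a + a' - a
  star t a a' := OmegaGroup.star t a a'

instance prodOmegaGroup (T : OpSignature.{v, w}) (X Y : Type u) [OmegaGroup T X] [OmegaGroup T Y] :
    OmegaGroup T (X × Y) where
  unary o x := (OmegaGroup.unary o x.1, OmegaGroup.unary o x.2)
  star s x y := (OmegaGroup.star s x.1 y.1, OmegaGroup.star s x.2 y.2)

theorem eval_prod {T : OpSignature.{v, w}} {V : Type*} {X Y : Type u} [OmegaGroup T X]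
    [OmegaGroup T Y] (x : V → X × Y) (t : OpTerm T V) :
    t.eval x = (t.eval (fun i => (x i).1), t.eval (fun i => (x i).2)) := by
  induction t with
  | var i => rfl
  | zero => rfl
  | neg t ih => simp only [OpTerm.eval, ih]; rfl
  | add t₁ t₂ h₁ h₂ => simp only [OpTerm.eval, h₁, h₂]; rfl
  | unary o t ih => simp only [OpTerm.eval, ih]; rfl
  | star s t₁ t₂ h₁ h₂ => simp only [OpTerm.eval, h₁, h₂]; rfl

variable {C}

theorem Obj.prod {X Y : Type u} [OmegaGroup C.sig X] [OmegaGroup C.sig Y]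
    (hX : C.Obj X) (hY : C.Obj Y) : C.Obj (X × Y) where
  star_opp s x y := Prod.ext (hX.star_opp ..) (hY.star_opp ..)
  star_add s x y z := Prod.ext (hX.star_add ..) (hY.star_add ..)
  unary_add o x y := Prod.ext (hX.unary_add ..) (hY.unary_add ..)
  unary_star o s x y := Prod.ext (hX.unary_star ..) (hY.unary_star ..)
  add_star_comm s x y z := Prod.ext (hX.add_star_comm ..) (hY.add_star_comm ..)
  star_star s t x y z := by
    rw [eval_prod]
    refine Prod.ext ((hX.star_star s t x.1 y.1 z.1).trans ?_)
      ((hY.star_star s t x.2 y.2 z.2).trans ?_)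
    · exact congrArg (fun f => OpTerm.eval f _) (funext fun m => by cases m <;> rfl)
    · exact congrArg (fun f => OpTerm.eval f _) (funext fun m => by cases m <;> rfl)
  identity e he x := by
    rw [eval_prod, eval_prod, hX.identity e he, hY.identity e he]

/-- Conjugation is an action in `C`; a split extension is `A → A × A → A` with the diagonal as its
section. -/
theorem Obj.isDerived_conj {A : Type u} [OmegaGroup C.sig A] (hA : C.Obj A) :
    C.IsDerived (C.conj A) := by
  have hsz : ∀ (t : C.sig.Star) (x : A), OmegaGroup.star t x (0 : A) = 0 := fun t x =>
    map_zero (AddMonoidHom.mk' (OmegaGroup.star t x) (hA.star_add t x))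
  have huz : ∀ (o : C.sig.Unary), OmegaGroup.unary o (0 : A) = 0 := fun o =>
    map_zero (AddMonoidHom.mk' (OmegaGroup.unary (T := C.sig) o) (hA.unary_add o))
  refine ⟨A × A, inferInstance, fun a => (a, 0), Prod.snd, fun a => (a, a), hA.prod hA,
    ⟨fun x y => ?_, fun o x => ?_, fun s x y => ?_⟩,
    ⟨fun _ _ => rfl, fun _ _ => rfl, fun _ _ _ => rfl⟩,
    ⟨fun _ _ => rfl, fun _ _ => rfl, fun _ _ _ => rfl⟩,
    fun x y h => congrArg Prod.fst h, fun x => ⟨(0, x), rfl⟩, fun x => ?_, fun _ => rfl,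
    fun b a => ?_, fun t b a => ?_⟩
  · exact Prod.ext rfl (add_zero 0).symm
  · exact Prod.ext rfl (huz o).symm
  · exact Prod.ext rfl (hsz s 0).symm
  · constructor
    · intro h
      exact ⟨x.1, Prod.ext rfl h.symm⟩
    · rintro ⟨y, rfl⟩
      rfl
  · refine Prod.ext rfl ?_
    change (0 : A) = b + 0 - b
    simp
  · exact Prod.ext rfl (hsz t b).symm

/-- The map `d : A → 𝔅(A)`, with `d(a) · a' = a + a' - a` and `d(a) * a' = a * a'`. -/
noncomputable def d {A : Type u} [OmegaGroup C.sig A] (hA : C.Obj A) (a : A) : C.BAlg A :=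
  ⟨toOps hA.isDerived_conj a, .gen hA _ hA.isDerived_conj a⟩

end CategoryOfInterest

/-- The words built from the group operations and the operations in `Ω₁'` only. -/
def OpTerm.StarFree {T : OpSignature.{v, w}} {V : Type u} : OpTerm T V → Prop
  | .var _ => True
  | .zero => True
  | .neg t => t.StarFree
  | .add t₁ t₂ => t₁.StarFree ∧ t₂.StarFree
  | .unary _ t => t.StarFree
  | .star _ _ _ => False

namespace CategoryOfInterest

variable {C : CategoryOfInterest.{v, w}}

/-- Every `ω ∈ Ω₁'` as an additive map. -/
def Obj.unaryHom {A : Type u} [OmegaGroup C.sig A] (hA : C.Obj A) (o : C.sig.Unary) : A →+ A :=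
  AddMonoidHom.mk' (OmegaGroup.unary (T := C.sig) o) (hA.unary_add o)

/-- The elements on which all iterated operations from `Ω₁'` commute. -/
def Obj.commuting {A : Type u} [OmegaGroup C.sig A] (hA : C.Obj A) : AddSubgroup A where
  carrier := {z | ∀ (l : List C.sig.Unary) (o o' : C.sig.Unary),
    OmegaGroup.unary o (OmegaGroup.unary o' (C.iterUnary l z)) =
      OmegaGroup.unary o' (OmegaGroup.unary o (C.iterUnary l z))}
  zero_mem' l o o' := by
    have h : C.iterUnary l (0 : A) = 0 := by
      induction l with
      | nil => rfl
      | cons o l ih => exact (congrArg _ ih).trans (map_zero (hA.unaryHom o))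
    rw [h]
    change hA.unaryHom o (hA.unaryHom o' 0) = hA.unaryHom o' (hA.unaryHom o 0)
    simp
  neg_mem' {x} hx l o o' := by
    have h : C.iterUnary l (-x) = -C.iterUnary l x := by
      induction l with
      | nil => rfl
      | cons o l ih => exact (congrArg _ ih).trans (map_neg (hA.unaryHom o) _)
    rw [h]
    change hA.unaryHom o (hA.unaryHom o' _) = hA.unaryHom o' (hA.unaryHom o _)
    simp only [map_neg]
    exact congrArg Neg.neg (hx l o o')
  add_mem' {x y} hx hy l o o' := by
    have h : C.iterUnary l (x + y) = C.iterUnary l x + C.iterUnary l y := by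
      induction l with
      | nil => rfl
      | cons o l ih => exact (congrArg _ ih).trans (map_add (hA.unaryHom o) _ _)
    rw [h]
    change hA.unaryHom o (hA.unaryHom o' _) = hA.unaryHom o' (hA.unaryHom o _)
    simp only [map_add]
    exact congrArg₂ (· + ·) (hx l o o') (hy l o o')

theorem Obj.unary_mem_commuting {A : Type u} [OmegaGroup C.sig A] (hA : C.Obj A)
    (o : C.sig.Unary) {x : A} (hx : x ∈ hA.commuting) : OmegaGroup.unary o x ∈ hA.commuting := by
  intro l p p'
  have := hx (l ++ [o]) p p'
  simpa [iterUnary] using this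

theorem Obj.eval_starFree {A : Type u} [OmegaGroup C.sig A] (hA : C.Obj A) {V : Type*}
    {x : V → A} (hx : ∀ i, x i ∈ hA.commuting) (o : C.sig.Unary) (t : OpTerm C.sig V)
    (ht : t.StarFree) : t.eval x ∈ hA.commuting ∧
      t.eval (fun i => OmegaGroup.unary o (x i)) = OmegaGroup.unary o (t.eval x) := by
  induction t with
  | var i => exact ⟨hx i, rfl⟩
  | zero => exact ⟨zero_mem _, (map_zero (hA.unaryHom o)).symm⟩
  | neg t ih =>
    obtain ⟨h1, h2⟩ := ih ht
    exact ⟨neg_mem h1, (congrArg _ h2).trans (map_neg (hA.unaryHom o) _).symm⟩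
  | add t₁ t₂ ih₁ ih₂ =>
    obtain ⟨h1, h2⟩ := ih₁ ht.1
    obtain ⟨h3, h4⟩ := ih₂ ht.2
    exact ⟨add_mem h1 h3, (congrArg₂ _ h2 h4).trans (map_add (hA.unaryHom o) _ _).symm⟩
  | unary p t ih =>
    obtain ⟨h1, h2⟩ := ih ht
    exact ⟨hA.unary_mem_commuting p h1, (congrArg _ h2).trans (h1 [] p o)⟩
  | star s t₁ t₂ _ _ => exact ht.elim

/-- If these words `W` are built from the group operations and `Ω₁'`, then `ω b * a = ω (b * a)`
for `b ∈ 𝔅(A)`. -/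
theorem MemB.star_unary {A : Type u} [OmegaGroup C.sig A] (hA : C.Obj A)
    (hW : ∀ s t, (C.word s t).StarFree) {f : C.Ops A} (hf : C.MemB A f) :
    ∀ l t a, (f l).2 t a ∈ hA.commuting ∧
      ∀ o, (f l).2 t (OmegaGroup.unary o a) = OmegaGroup.unary o ((f l).2 t a) ∧
        (f (o :: l)).2 t a = OmegaGroup.unary o ((f l).2 t a) := by
  induction hf with
  | @gen B _ hB α h b =>
    obtain ⟨E, _, i, p, s, hE, hi, -, hs, hij, -, -, -, -, hst⟩ := id h
    have h1 : ∀ t b o a, α.star t b (OmegaGroup.unary o a) = OmegaGroup.unary o (α.star t b a) :=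
      fun t b o a => hij (by
        rw [hst, hi.map_unary, hi.map_unary, hst, ← hE.star_opp, hE.unary_star, hE.star_opp])
    have h2 : ∀ t b o a, α.star t (OmegaGroup.unary o b) a = OmegaGroup.unary o (α.star t b a) :=
      fun t b o a => hij (by rw [hst, hi.map_unary, hst, hs.map_unary, hE.unary_star])
    have h3 : ∀ t l b a, C.iterUnary l (α.star t b a) = α.star t (C.iterUnary l b) a := by
      intro t l b a
      induction l with
      | nil => rfl
      | cons o l ih => exact (congrArg _ ih).trans (h2 _ _ _ _).symm
    intro l t a
    refine ⟨fun l' o o' => ?_, fun o => ⟨h1 _ _ _ _, h2 _ _ _ _⟩⟩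
    change OmegaGroup.unary o (OmegaGroup.unary o' (C.iterUnary l' (α.star t _ a))) =
      OmegaGroup.unary o' (OmegaGroup.unary o (C.iterUnary l' (α.star t _ a)))
    rw [h3, ← h2, ← h1, ← h1, ← h2]
  | zero =>
    exact fun l t a => ⟨zero_mem _, fun o =>
      ⟨(map_zero (hA.unaryHom o)).symm, (map_zero (hA.unaryHom o)).symm⟩⟩
  | @neg f _ ih =>
    exact fun l t a => ⟨neg_mem (ih l t a).1, fun o =>
      ⟨(congrArg _ ((ih l t a).2 o).1).trans (map_neg (hA.unaryHom o) _).symm,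
        (congrArg _ ((ih l t a).2 o).2).trans (map_neg (hA.unaryHom o) _).symm⟩⟩
  | @add f g _ _ ih₁ ih₂ =>
    exact fun l t a => ⟨add_mem (ih₁ l t a).1 (ih₂ l t a).1, fun o =>
      ⟨(congrArg₂ _ ((ih₁ l t a).2 o).1 ((ih₂ l t a).2 o).1).trans
          (map_add (hA.unaryHom o) _ _).symm,
        (congrArg₂ _ ((ih₁ l t a).2 o).2 ((ih₂ l t a).2 o).2).trans
          (map_add (hA.unaryHom o) _ _).symm⟩⟩
  | unary o _ ih => exact fun l t a => ih (l ++ [o]) t a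
  | @star s f g _ _ ih₁ ih₂ =>
    intro l t a
    have hm : ∀ m, Mono.actEval (f l).2 (g []).2 a m ∈ hA.commuting := by
      intro m
      cases m <;> first | exact (ih₁ _ _ _).1 | exact (ih₂ _ _ _).1
    refine ⟨?_, fun o => ⟨?_, ?_⟩⟩
    · by_cases ho : Nonempty C.sig.Unary
      · exact (hA.eval_starFree hm ho.some _ (hW s t)).1
      · exact fun _ o => (ho ⟨o⟩).elim
    · refine Eq.trans ?_ (hA.eval_starFree hm o _ (hW s t)).2
      refine congrArg (fun x => OpTerm.eval x _) (funext fun m => ?_)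
      cases m <;> simp only [Mono.actEval, ((ih₁ _ _ _).2 o).1, ((ih₂ _ _ _).2 o).1]
    · refine Eq.trans ?_ (hA.eval_starFree hm o _ (hW s t)).2
      refine congrArg (fun x => OpTerm.eval x _) (funext fun m => ?_)
      cases m <;> simp only [Mono.actEval, ((ih₁ _ _ _).2 o).2, ((ih₂ _ _ _).2 o).1]

/-- In that case two elements of `𝔅(A)` are equal if and only if `b * a = b' * a` and
`ω₁ ⋯ ωₙ b · a = ω₁ ⋯ ωₙ b' · a` for all `a`, all `*` and all sequences `ω₁, …, ωₙ`. -/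
theorem BAlg.eq_iff {A : Type u} [OmegaGroup C.sig A] (hA : C.Obj A)
    (hW : ∀ s t, (C.word s t).StarFree) (b b' : C.BAlg A) :
    b = b' ↔ (∀ s a, b.star s a = b'.star s a) ∧
      ∀ l a, (C.iterUnary l b).dot a = (C.iterUnary l b').dot a := by
  refine ⟨by rintro rfl; exact ⟨fun _ _ => rfl, fun _ _ => rfl⟩, fun ⟨h1, h2⟩ => ?_⟩
  have hl : ∀ (l l' : List C.sig.Unary) (c : C.BAlg A), (C.iterUnary l c).1 l' = c.1 (l' ++ l) := by
    intro l
    induction l with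
    | nil => intro l' c; simp [iterUnary]
    | cons o l ih =>
      intro l' c
      exact (ih (l' ++ [o]) c).trans (by simp)
  refine Subtype.ext (funext fun l =>
    Prod.ext (Equiv.ext fun a => ?_) (funext fun t => funext fun a => ?_))
  · have := h2 l a
    simp only [BAlg.dot, Ops.dot, hl] at this
    exact this
  · induction l with
    | nil => exact h1 t a
    | cons o l ih =>
      exact ((b.2.star_unary hA hW l t a).2 o).2.trans
        ((congrArg _ ih).trans ((b'.2.star_unary hA hW l t a).2 o).2.symm)

end CategoryOfInterest

/-! For an object `B` of `C` acting on `A`, the map `b ↦ 𝐛` is a homomorphism: in the split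
extension the laws of `C` compute the actions of `x + y`, `ω x` and `x * y` by exactly the formulas
that define the operations on families of maps (`isOmegaHom_toOps`). For the actor this homomorphism
is the required bijection onto `𝔅(A)`.

It is surjective because any action of an object `D` factors through a morphism `φ` from `D` to the
actor, so each generator of `𝔅(A)` is the family of some `φ c` (`toOps_eq_of_hom`); the image is
closed under all operations, so it contains everything they generate.

It is injective by the uniqueness of `φ`. The kernel pair of `b ↦ 𝐛` is an object of `C`, and its
two projections to the actor induce the same action on `A`. That action is in `C`, since actions in
`C` pull back along morphisms (`IsDerived.pull`), so the projections coincide. -/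

namespace IsOmegaHom

/-! ### Homomorphisms and words. -/

variable {T : OpSignature.{v, w}} {X Y Z : Type*} [OmegaGroup T X] [OmegaGroup T Y]
  [OmegaGroup T Z]

theorem map_zero {f : X → Y} (hf : IsOmegaHom T f) : f 0 = 0 :=
  _root_.map_zero (AddMonoidHom.mk' f hf.map_add)

theorem map_neg {f : X → Y} (hf : IsOmegaHom T f) (x : X) : f (-x) = -f x :=
  _root_.map_neg (AddMonoidHom.mk' f hf.map_add) x

theorem comp {g : Y → Z} {f : X → Y} (hg : IsOmegaHom T g) (hf : IsOmegaHom T f) :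
    IsOmegaHom T (fun x => g (f x)) where
  map_add x y := by rw [hf.map_add, hg.map_add]
  map_unary o x := by rw [hf.map_unary, hg.map_unary]
  map_star s x y := by rw [hf.map_star, hg.map_star]

/-- Homomorphisms commute with the evaluation of words. -/
theorem map_eval {f : X → Y} (hf : IsOmegaHom T f) {V : Type*} (x : V → X) (t : OpTerm T V) :
    f (t.eval x) = t.eval fun i => f (x i) := by
  induction t with
  | var i => rfl
  | zero => exact hf.map_zero
  | neg t ih => simp only [OpTerm.eval, hf.map_neg, ih]
  | add t₁ t₂ h₁ h₂ => simp only [OpTerm.eval, hf.map_add, h₁, h₂]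
  | unary o t ih => simp only [OpTerm.eval, hf.map_unary, ih]
  | star s t₁ t₂ h₁ h₂ => simp only [OpTerm.eval, hf.map_star, h₁, h₂]

theorem map_monoEval {f : X → Y} (hf : IsOmegaHom T f) (x₁ x₂ x₃ : X) (m : Mono T) :
    f (m.eval x₁ x₂ x₃) = m.eval (f x₁) (f x₂) (f x₃) := by
  cases m <;> simp only [Mono.eval, hf.map_star]

end IsOmegaHom

namespace CategoryOfInterest

variable {C : CategoryOfInterest.{v, w}}

theorem map_iterUnary {X Y : Type*} [OmegaGroup C.sig X] [OmegaGroup C.sig Y] {f : X → Y}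
    (hf : IsOmegaHom C.sig f) (l : List C.sig.Unary) (x : X) :
    f (C.iterUnary l x) = C.iterUnary l (f x) := by
  induction l with
  | nil => rfl
  | cons o l ih => exact (hf.map_unary o _).trans (congrArg _ ih)

/-- An algebra that embeds into an object of `C` is an object of `C`. -/
theorem Obj.of_injective {X Y : Type*} [OmegaGroup C.sig X] [OmegaGroup C.sig Y] (hY : C.Obj Y)
    {f : X → Y} (hf : IsOmegaHom C.sig f) (hinj : Function.Injective f) : C.Obj X where
  star_opp s x y := hinj (by simp only [hf.map_star, hY.star_opp])
  star_add s x y z := hinj (by simp only [hf.map_star, hf.map_add, hY.star_add])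
  unary_add o x y := hinj (by simp only [hf.map_unary, hf.map_add, hY.unary_add])
  unary_star o s x y := hinj (by simp only [hf.map_unary, hf.map_star, hY.unary_star])
  add_star_comm s x y z := hinj (by
    simp only [hf.map_star, hf.map_add]
    exact hY.add_star_comm s _ _ _)
  star_star s t x y z := hinj (by
    simp only [hf.map_star, hf.map_eval, hf.map_monoEval]
    exact hY.star_star s t _ _ _)
  identity e he x := hinj (by
    simp only [hf.map_eval]
    exact hY.identity e he _)

/-! ### Fibre products. -/

section Pullback

variable {T : OpSignature.{v, w}} {X Y : Type u} {Z : Type*} [OmegaGroup T X] [OmegaGroup T Y]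
  [OmegaGroup T Z] {f : X → Z} {g : Y → Z}

/-- The fibre product of two homomorphisms as an additive subgroup of the product. -/
def pullbackSubgroup (hf : IsOmegaHom T f) (hg : IsOmegaHom T g) : AddSubgroup (X × Y) where
  carrier := {z | f z.1 = g z.2}
  zero_mem' := hf.map_zero.trans hg.map_zero.symm
  add_mem' hx hy :=
    (hf.map_add _ _).trans ((congrArg₂ _ hx hy).trans (hg.map_add _ _).symm)
  neg_mem' hx := (hf.map_neg _).trans ((congrArg _ hx).trans (hg.map_neg _).symm)

instance (hf : IsOmegaHom T f) (hg : IsOmegaHom T g) : OmegaGroup T (pullbackSubgroup hf hg) where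
  unary o x := ⟨OmegaGroup.unary o x.1,
    (hf.map_unary _ _).trans ((congrArg _ x.2).trans (hg.map_unary _ _).symm)⟩
  star s x y := ⟨OmegaGroup.star s x.1 y.1,
    (hf.map_star _ _ _).trans ((congrArg₂ _ x.2 y.2).trans (hg.map_star _ _ _).symm)⟩

theorem isOmegaHom_pullback_fst (hf : IsOmegaHom T f) (hg : IsOmegaHom T g) :
    IsOmegaHom T fun z : pullbackSubgroup hf hg => z.1.1 :=
  ⟨fun _ _ => rfl, fun _ _ => rfl, fun _ _ _ => rfl⟩

theorem isOmegaHom_pullback_snd (hf : IsOmegaHom T f) (hg : IsOmegaHom T g) :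
    IsOmegaHom T fun z : pullbackSubgroup hf hg => z.1.2 :=
  ⟨fun _ _ => rfl, fun _ _ => rfl, fun _ _ _ => rfl⟩

end Pullback

/-- The fibre product embeds into `X × Y`, so nothing is required of `Z`. This matters for the
kernel pair, where `Z` is `C.Ops A`, an algebra not known to satisfy the laws of `C` and possibly in
a larger universe. -/
theorem Obj.pullback {X Y : Type u} {Z : Type*} [OmegaGroup C.sig X] [OmegaGroup C.sig Y]
    [OmegaGroup C.sig Z] {f : X → Z} {g : Y → Z} (hX : C.Obj X) (hY : C.Obj Y)
    (hf : IsOmegaHom C.sig f) (hg : IsOmegaHom C.sig g) : C.Obj (pullbackSubgroup hf hg) :=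
  (hX.prod hY).of_injective (f := Subtype.val)
    ⟨fun _ _ => rfl, fun _ _ => rfl, fun _ _ _ => rfl⟩ Subtype.val_injective

theorem Obj.star_zero {X : Type*} [OmegaGroup C.sig X] (hX : C.Obj X) (s : C.sig.Star) (x : X) :
    OmegaGroup.star s x (0 : X) = 0 :=
  map_zero (AddMonoidHom.mk' (OmegaGroup.star s x) (hX.star_add s x))

theorem Obj.isOmegaHom_zero {X Y : Type*} [OmegaGroup C.sig X] [OmegaGroup C.sig Y]
    (hY : C.Obj Y) : IsOmegaHom C.sig fun _ : X => (0 : Y) where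
  map_add _ _ := (add_zero 0).symm
  map_unary o _ := (map_zero (hY.unaryHom o)).symm
  map_star s _ _ := (hY.star_zero s 0).symm

/-- The action of `D` on `A` induced by an action of `B` on `A` and a map `D → B`. -/
def pullAction {T : OpSignature.{v, w}} {A B D : Type u} (α : ActionSet T B A) (φ : D → B) :
    ActionSet T D A where
  dot c a := α.dot (φ c) a
  star t c a := α.star t (φ c) a

/-! ### Pulling back actions, and the homomorphism `b ↦ 𝐛`. -/

section Derived

variable {A B D : Type u} [OmegaGroup C.sig A] [OmegaGroup C.sig B] [OmegaGroup C.sig D]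

/-- An action in `C` pulled back along a morphism of `C` is an action in `C`. -/
theorem IsDerived.pull {α : ActionSet C.sig B A} (h : C.IsDerived α) (hD : C.Obj D) {φ : D → B}
    (hφ : IsOmegaHom C.sig φ) : C.IsDerived (pullAction α φ) := by
  obtain ⟨E, _, i, p, s, hE, hi, hp, hs, hij, -, hk, hps, hd, hst⟩ := h
  have hpi : ∀ a, p (i a) = 0 := fun a => (hk _).2 ⟨a, rfl⟩
  have hz := hD.isOmegaHom_zero (X := A)
  -- The extension of `D` is the fibre product of `p : E → B` and `φ`, with kernel inclusion `a ↦ (i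
  -- a, 0)` and section `c ↦ (s (φ c), c)`.
  refine ⟨pullbackSubgroup hp hφ, inferInstance, fun a => ⟨(i a, 0), ?_⟩, fun z => z.1.2,
    fun c => ⟨(s (φ c), c), hps _⟩, hE.pullback hD hp hφ, ⟨?_, ?_, ?_⟩,
    isOmegaHom_pullback_snd hp hφ, ⟨?_, ?_, ?_⟩, ?_, ?_, ?_, fun _ => rfl, ?_, ?_⟩
  · exact (hpi a).trans hφ.map_zero.symm
  · exact fun x y => Subtype.ext (Prod.ext (hi.map_add x y) (hz.map_add x y))
  · exact fun o x => Subtype.ext (Prod.ext (hi.map_unary o x) (hz.map_unary o x))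
  · exact fun t x y => Subtype.ext (Prod.ext (hi.map_star t x y) (hz.map_star t x y))
  · exact fun x y => Subtype.ext (Prod.ext ((hs.comp hφ).map_add x y) rfl)
  · exact fun o x => Subtype.ext (Prod.ext ((hs.comp hφ).map_unary o x) rfl)
  · exact fun t x y => Subtype.ext (Prod.ext ((hs.comp hφ).map_star t x y) rfl)
  · exact fun x y hxy => hij (congrArg (fun z => z.1.1) hxy)
  · exact fun c => ⟨⟨(s (φ c), c), hps _⟩, rfl⟩
  · rintro ⟨⟨x, c⟩, hx⟩
    constructor
    · intro hc
      obtain rfl : c = 0 := hc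
      obtain ⟨a, rfl⟩ := (hk x).1 (Eq.trans hx hφ.map_zero)
      exact ⟨a, rfl⟩
    · rintro ⟨a, ha⟩
      exact (congrArg (fun z => z.1.2) ha).symm
  · intro c a
    refine Subtype.ext (Prod.ext (hd _ _) ?_)
    change (0 : D) = c + 0 - c
    simp
  · exact fun t c a => Subtype.ext (Prod.ext (hst _ _ _) (hD.star_zero t c).symm)

variable {α : ActionSet C.sig B A}

theorem Ops.ext' {f g : C.Ops A} (h₁ : ∀ l a, (f l).1.toMul a = (g l).1.toMul a)
    (h₂ : ∀ l t a, (f l).2 t a = (g l).2 t a) : f = g :=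
  funext fun l => Prod.ext (Equiv.ext (h₁ l)) (funext fun t => funext (h₂ l t))

/-- A family also records the actions of all `ω₁ ⋯ ωₙ c`; these agree as well because `φ` commutes
with the operations in `Ω₁'`. -/
theorem toOps_eq_of_hom {β : ActionSet C.sig D A} (h : C.IsDerived α) (hβ : C.IsDerived β)
    {φ : D → B} (hφ : IsOmegaHom C.sig φ) (hdot : ∀ c a, β.dot c a = α.dot (φ c) a)
    (hstar : ∀ t c a, β.star t c a = α.star t (φ c) a) (c : D) :
    toOps hβ c = toOps h (φ c) := by
  refine Ops.ext' (fun l a => ?_) fun l t a => ?_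
  · change β.dot (C.iterUnary l c) a = α.dot (C.iterUnary l (φ c)) a
    rw [hdot, map_iterUnary hφ]
  · change β.star t (C.iterUnary l c) a = α.star t (C.iterUnary l (φ c)) a
    rw [hstar, map_iterUnary hφ]

theorem Obj.iterUnary_add {X : Type*} [OmegaGroup C.sig X] (hX : C.Obj X)
    (l : List C.sig.Unary) (x y : X) :
    C.iterUnary l (x + y) = C.iterUnary l x + C.iterUnary l y := by
  induction l with
  | nil => rfl
  | cons o l ih => exact (congrArg _ ih).trans (hX.unary_add _ _ _)

/-- The unary operations are absorbed by the first factor alone, which is why the product in `C.Ops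
A` takes `f` at the sequence `l` but `g` at the empty one. -/
theorem Obj.iterUnary_star {X : Type*} [OmegaGroup C.sig X] (hX : C.Obj X)
    (l : List C.sig.Unary) (s : C.sig.Star) (x y : X) :
    C.iterUnary l (OmegaGroup.star s x y) = OmegaGroup.star s (C.iterUnary l x) y := by
  induction l with
  | nil => rfl
  | cons o l ih => exact (congrArg _ ih).trans (hX.unary_star _ _ _ _).symm

/-- Sending an element of an object acting on `A` to its family of actions is a homomorphism. -/
theorem isOmegaHom_toOps (hB : C.Obj B) (h : C.IsDerived α) : IsOmegaHom C.sig (toOps h) := by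
  obtain ⟨E, _, i, p, s, hE, hi, -, hs, hij, -, -, -, hd, hst⟩ := id h
  refine ⟨fun x y => Ops.ext' (fun l a => hij ?_) fun l t a => hij ?_, fun o x => ?_,
    fun r x y => Ops.ext' (fun l a => hij ?_) fun l t a => hij ?_⟩
  · change i (α.dot (C.iterUnary l (x + y)) a) =
      i (α.dot (C.iterUnary l x) (α.dot (C.iterUnary l y) a))
    simp only [hd, hB.iterUnary_add, hs.map_add, sub_eq_add_neg, neg_add_rev, add_assoc]
  · change i (α.star t (C.iterUnary l (x + y)) a) =
      i (α.star t (C.iterUnary l x) a + α.star t (C.iterUnary l y) a)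
    -- Distributivity is a law only in the second argument; passing to `*°` and back gives it in the
    -- first.
    rw [hi.map_add, hst, hst, hst, hB.iterUnary_add, hs.map_add, ← hE.star_opp, hE.star_add,
      hE.star_opp, hE.star_opp]
  · refine funext fun l => ?_
    have hl : C.iterUnary l (OmegaGroup.unary o x) = C.iterUnary (l ++ [o]) x := by
      simp [iterUnary]
    refine Prod.ext (Equiv.ext fun a => ?_) (funext fun t => funext fun a => ?_)
    · exact congrArg (fun b => α.dot b a) hl
    · exact congrArg (fun b => α.star t b a) hl
  · change i (α.dot (C.iterUnary l (OmegaGroup.star r x y)) a) = i a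
    -- Values of `*` are central in `E`, so conjugation by them is trivial.
    rw [hd, hB.iterUnary_star, hs.map_star, ← hE.add_star_comm, add_sub_cancel_right]
  · change i (α.star t (C.iterUnary l (OmegaGroup.star r x y)) a) =
      i ((C.word r t).eval (Mono.actEval (fun q b => α.star q (C.iterUnary l x) b)
        (fun q b => α.star q y b) a))
    -- This is the identity `(x₁ * x₂) *̄ x₃ = W` in `E` at `x₃ = i a`. Each of the eight monomials
    -- contains `x₃` once, in its inner product, so it is two successive star actions on `a`, with
    -- `*°` wherever the acting element stands on the right.
    rw [hst, hB.iterUnary_star, hs.map_star, hE.star_star, hi.map_eval]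
    refine congrArg (fun v => OpTerm.eval v _) (funext fun m => ?_)
    cases m <;> simp only [Mono.eval, Mono.actEval, hst, hE.star_opp]

/-- The homomorphism `b ↦ 𝐛` with values in `𝔅(A)`. -/
noncomputable def toBAlg (hB : C.Obj B) (h : C.IsDerived α) (b : B) : C.BAlg A :=
  ⟨toOps h b, .gen hB α h b⟩

theorem isOmegaHom_toBAlg (hB : C.Obj B) (h : C.IsDerived α) :
    IsOmegaHom C.sig (toBAlg hB h) where
  map_add x y := Subtype.ext ((isOmegaHom_toOps hB h).map_add x y)
  map_unary o x := Subtype.ext ((isOmegaHom_toOps hB h).map_unary o x)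
  map_star s x y := Subtype.ext ((isOmegaHom_toOps hB h).map_star s x y)

end Derived

/-! ### The actor and `𝔅(A)`. -/

namespace IsActor

variable {A B : Type u} [OmegaGroup C.sig A] [OmegaGroup C.sig B] {del : A → B}
  {α : ActionSet C.sig B A}

/-- Elements of an actor are determined by their actions and those of their images under `Ω₁'`. -/
theorem toOps_injective (h : C.IsActor del α) :
    Function.Injective (toOps h.crossed.derived) := by
  intro b b' hbb
  have hB := h.crossed.obj_target
  have he := isOmegaHom_toOps hB h.crossed.derived
  have hK := hB.pullback hB he he
  have h₁ := isOmegaHom_pullback_fst he he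
  have h₂ := isOmegaHom_pullback_snd he he
  -- The kernel pair acts on `A` through its first projection. The second projection induces the
  -- same action, so the two are equal, in particular at `(b, b')`.
  refine congrFun ((h.universal _ hK _ (h.crossed.derived.pull hK h₁)).unique
    ⟨h₁, fun _ _ => rfl, fun _ _ _ => rfl⟩ ⟨h₂, fun c a => ?_, fun t c a => ?_⟩) ⟨(b, b'), hbb⟩
  · exact congrArg (fun f => Ops.dot f a) c.2
  · exact congrArg (fun f => Ops.star f t a) c.2

/-- Existence in the universal property handles the generators; for the other elements it is enough
that the image of a homomorphism is closed under all operations. -/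
theorem exists_toOps_eq (h : C.IsActor del α) {f : C.Ops A} (hf : C.MemB A f) :
    ∃ b, toOps h.crossed.derived b = f := by
  have he := isOmegaHom_toOps h.crossed.obj_target h.crossed.derived
  induction hf with
  | gen hD β hβ c =>
    obtain ⟨φ, ⟨hφ, hdot, hstar⟩, -⟩ := h.universal _ hD β hβ
    exact ⟨φ c, (toOps_eq_of_hom h.crossed.derived hβ hφ hdot hstar c).symm⟩
  | zero => exact ⟨0, he.map_zero⟩
  | neg _ ih =>
    obtain ⟨x, rfl⟩ := ih
    exact ⟨-x, he.map_neg x⟩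
  | add _ _ ih₁ ih₂ =>
    obtain ⟨x, rfl⟩ := ih₁
    obtain ⟨y, rfl⟩ := ih₂
    exact ⟨x + y, he.map_add x y⟩
  | unary o _ ih =>
    obtain ⟨x, rfl⟩ := ih
    exact ⟨OmegaGroup.unary o x, he.map_unary o x⟩
  | star s _ _ ih₁ ih₂ =>
    obtain ⟨x, rfl⟩ := ih₁
    obtain ⟨y, rfl⟩ := ih₂
    exact ⟨OmegaGroup.star s x y, he.map_star s x y⟩

theorem toBAlg_bijective (h : C.IsActor del α) :
    Function.Bijective (toBAlg h.crossed.obj_target h.crossed.derived) :=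
  ⟨fun _ _ hxy => h.toOps_injective (congrArg Subtype.val hxy), fun f =>
    (h.exists_toOps_eq f.2).imp fun _ hb => Subtype.ext hb⟩

end IsActor

end CategoryOfInterest

open CategoryOfInterest in
theorem proposition3p5 (C : CategoryOfInterest.{v, w}) {A B : Type u}
    [OmegaGroup C.sig A] [OmegaGroup C.sig B] (hA : C.Obj A)
    (del : A → B) (α : ActionSet C.sig B A) (hB : C.IsActor del α) :
    ∃ e : B ≃ C.BAlg A, IsOmegaHom C.sig e ∧
      (∀ b a, (e b).dot a = α.dot b a) ∧
      (∀ s b a, (e b).star s a = α.star s b a) ∧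
      ∀ a, e (del a) = CategoryOfInterest.d hA a := by
  refine ⟨Equiv.ofBijective _ hB.toBAlg_bijective,
    isOmegaHom_toBAlg hB.crossed.obj_target hB.crossed.derived, fun _ _ => rfl,
    fun _ _ _ => rfl, fun a => Subtype.ext ?_⟩
  -- The crossed module laws for `∂(a) · a'` and `∂(a) * a'` say that conjugation is the action of
  -- the actor pulled back along the morphism `∂`.
  exact (toOps_eq_of_hom hB.crossed.derived hA.isDerived_conj hB.crossed.hom
    (fun c a => (hB.crossed.dot_del c a).symm)
    (fun t c a => (hB.crossed.star_del t c a).symm) a).symm
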